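/- **Theorem 5.3.** Let $\Sigma$ be a finite alphabet. *Automata.* The input tape holds $\#w\#$, with $\#\notin\Sigma$ as the end-marker on both sides, for $w\in\Sigma^*$. All heads are read-only, start on the left end-marker, and in each step either stay put or move one square to the right; they never leave the tape (an instruction to move right on the right end-marker leaves the head in place). A 1nfa($k$) is a nondeterministic finite automaton with $k$ such heads: depending on its state and the $k$ scanned symbols it chooses among finitely many pairs of a new state and a tuple of head moves, and it accepts $w$ if some computation from the start state reaches an accepting state. $\mathsf{1NFA}(k)$ is the class of languages over $\Sigma$ recognized by 1nfa($k$)'s. *Verifiers.* A $k$-head one-way verifier $V$ is a finite automaton with $k$ such heads whose states are coin-tossing states, deterministic states, an accepting and a rejecting halting state; the start state is non-halting. It has a finite communication alphabet $\Gamma$ with a null symbol $\epsilon$, and each non-halting state $q$ has a symbol $\gamma_q\in\Gamma$. Each time $V$ is about to make a move from a non-halting state $q$ with $\gamma_q\ne\epsilon$, it sends $\gamma_q$ to the prover and receives a response in $\Gamma$; if $\gamma_q=\epsilon$ there is no communication and the symbol received is taken to be $\epsilon$. The move (new state and head moves) is determined by $q$, the $k$ scanned symbols, the symbol received and, if $q$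 is coin-tossing, a fresh fair random bit. A (two-way) prover is a function that determines each response from the input and the entire communication so far, including the symbol just sent. A one-way prover assigns to each input an infinite sequence over $\Gamma$, whose $i$-th symbol is the response in the $i$-th communication step. $V$ uses constantly many random bits if there is an $r$ such that on all inputs, against all provers and for all outcomes of the coin tosses, $V$ tosses at most $r$ coins. *Proof systems.* Under two-way (respectively one-way) communication, all provers are two-way (respectively one-way). $V$ verifies $L\subseteq\Sigma^*$ with error $\varepsilon$ if 1. there is a prover $P$ such that for every $w\in L$ the interaction of $P$ and $V$ on $w$ ends in acceptance with probability at least $1-\varepsilon$; and 2. for every $w\notin L$ and every prover $P^*$, the interaction of $P^*$ and $V$ on $w$ ends in rejection with probability at least $1-\varepsilon$ (strong definition), respectively in acceptance with probability at most $\varepsilon$ (weak definition). *Claim.* For each of the four combinations of strong or weak definition and one-way or two-way communication, the class of languages $L\subseteq\Sigma^*$ that are verified, with some error $0\le\varepsilon<\frac12$, by some $k$-head one-way verifier ($k\ge 1$) that uses constantly many random bits is exactly $$\bigcup_{k\ge 1}\mathsf{1NFA}(k).$$ -/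

import Mathlib

open MeasureTheory

namespace MultiheadVerifier

/-! ### Input tape and one-way heads -/

/-- The input tape `¢ w ¢`: squares `0` and `w.length + 1` hold the end-marker `¢`
(written `none`), and square `i + 1` holds the `i`-th letter of `w`. -/
def tape {α : Type*} (w : List α) : ℕ → Option α
  | 0 => none
  | i + 1 => w[i]?

/-- The tuple of symbols scanned by `k` heads. -/
def scan {α : Type*} {k : ℕ} (w : List α) (p : Fin k → ℕ) : Fin k → Option α :=
  fun i => tape w (p i)

/-- Head `i` moves by `d i ∈ {0, +1}`.  Heads do not leave the tape: an instruction to move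
right on the right end-marker leaves the head where it is. -/
def move {α : Type*} {k : ℕ} (w : List α) (p : Fin k → ℕ) (d : Fin k → Fin 2) : Fin k → ℕ :=
  fun i => min (p i + (d i : ℕ)) (w.length + 1)

/-! ### Nondeterministic one-way multihead finite automata -/

/-- A `1nfa(k)`: a nondeterministic finite automaton with `k` one-way heads. -/
structure OneWayNFA (α : Type*) (k : ℕ) where
  Q : Type
  [finQ : Finite Q]
  start : Q
  accept : Set Q
  δ : Q → (Fin k → Option α) → Set (Q × (Fin k → Fin 2))

namespace OneWayNFA

variable {α : Type*} {k : ℕ} (M : OneWayNFA α k)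

/-- One computation step on input `w`; a configuration is a state with the head positions. -/
def Step (w : List α) (c c' : M.Q × (Fin k → ℕ)) : Prop :=
  ∃ d : Fin k → Fin 2, (c'.1, d) ∈ M.δ c.1 (scan w c.2) ∧ c'.2 = move w c.2 d

/-- `w` is accepted if some computation that starts in the start state, with all heads on the
left end-marker, reaches an accepting state. -/
def language : Language α :=
  {w | ∃ q ∈ M.accept, ∃ p : Fin k → ℕ,
    Relation.ReflTransGen (M.Step w) (M.start, fun _ => 0) (q, p)}

end OneWayNFA

/-- The class `1NFA(k)` of languages over `α`. -/
def classOneNFA (α : Type*) (k : ℕ) : Set (Language α) :=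
  {L | ∃ M : OneWayNFA α k, M.language = L}

/-! ### Verifiers -/

/-- The states of a verifier: coin-tossing states `R`, deterministic states `D`, and the two
halting states. -/
inductive VState (R D : Type) : Type
  | coin (q : R)
  | det (q : D)
  | accept
  | reject

/-- A probabilistic finite automaton with `k` one-way heads, as a verifier.  `Γ` is the
communication alphabet, with its null symbol; `msg q` is the communication symbol of the
non-halting state `q`. The arguments of the transition functions are the state, the scanned
symbols, the content of the communication cell and, in coin-tossing states, the random bit. -/
structure Verifier (α : Type*) (k : ℕ) where
  R : Type
  D : Type
  Γ : Type
  [finR : Finite R]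
  [finD : Finite D]
  [finΓ : Finite Γ]
  null : Γ
  start : R ⊕ D
  msg : R ⊕ D → Γ
  δcoin : R → (Fin k → Option α) → Γ → Bool → VState R D × (Fin k → Fin 2)
  δdet : D → (Fin k → Option α) → Γ → VState R D × (Fin k → Fin 2)

/-- A prover: from the input string, the communication so far (the list, oldest first, of the
pairs of a symbol sent by the verifier and the response to it) and the symbol just sent by the
verifier, it determines the response. -/
abbrev Prover (α : Type*) (Γ : Type) : Type _ :=
  List α → List (Γ × Γ) → Γ → Γ

/-- A one-way prover maps each input string to a sequence of symbols; its response in the `i`-th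
communication step is the `i`-th symbol of that sequence. -/
def Prover.IsOneWay {α : Type*} {Γ : Type} (P : Prover α Γ) : Prop :=
  ∃ c : List α → ℕ → Γ, ∀ w h s, P w h s = c w h.length

namespace Verifier

variable {α : Type*} {k : ℕ} (V : Verifier α k)

/-- A snapshot of an interaction: the state and head positions of the verifier, the number of
coins tossed so far, and the communication so far. -/
structure Snapshot where
  state : VState V.R V.D
  heads : Fin k → ℕ
  tossed : ℕ
  history : List (V.Γ × V.Γ)

/-- The snapshot at the start: all heads are on the left end-marker. -/
def init : V.Snapshot where
  state := Sum.elim VState.coin VState.det V.start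
  heads := fun _ => 0
  tossed := 0
  history := []

open Classical in
/-- The symbol read by the verifier from the communication cell in the non-halting state `q`,
and the updated communication.  If the communication symbol of `q` is the null symbol, there is
no communication (and the null symbol is read). -/
noncomputable def communicate (P : Prover α V.Γ) (w : List α) (h : List (V.Γ × V.Γ))
    (q : V.R ⊕ V.D) : V.Γ × List (V.Γ × V.Γ) :=
  if V.msg q = V.null then (V.null, h)
  else (P w h (V.msg q), h ++ [(V.msg q, P w h (V.msg q))])

/-- One step of the interaction with the prover `P` on input `w`, where the `j`-th coin toss
(counted from `0`) gives the bit `β j`. Halting states are never left. -/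
noncomputable def step (P : Prover α V.Γ) (w : List α) (β : ℕ → Bool) (c : V.Snapshot) :
    V.Snapshot :=
  match c.state with
  | .accept => c
  | .reject => c
  | .coin q =>
      let m := V.communicate P w c.history (Sum.inl q)
      let t := V.δcoin q (scan w c.heads) m.1 (β c.tossed)
      { state := t.1
        heads := move w c.heads t.2
        tossed := c.tossed + 1
        history := m.2 }
  | .det q =>
      let m := V.communicate P w c.history (Sum.inr q)
      let t := V.δdet q (scan w c.heads) m.1
      { state := t.1
        heads := move w c.heads t.2
        tossed := c.tossed
        history := m.2 }

/-- The snapshot after `n` steps. -/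
noncomputable def run (P : Prover α V.Γ) (w : List α) (β : ℕ → Bool) (n : ℕ) : V.Snapshot :=
  (V.step P w β)^[n] V.init

/-- The verifier never tosses more than `r` coins, on any input, against any prover, and for any
outcome of the coin tosses. -/
def UsesAtMost (r : ℕ) : Prop :=
  ∀ (w : List α) (P : Prover α V.Γ) (β : ℕ → Bool) (n : ℕ), (V.run P w β n).tossed ≤ r

end Verifier

/-- The law of a sequence of independent fair coin tosses. -/
noncomputable def coinMeasure : Measure (ℕ → Bool) :=
  Measure.infinitePi fun _ => (PMF.uniformOfFintype Bool).toMeasure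

namespace Verifier

variable {α : Type*} {k : ℕ} (V : Verifier α k)

/-- The probability that the interaction of `P` and `V` on `w` results in acceptance. -/
noncomputable def acceptProb (P : Prover α V.Γ) (w : List α) : ℝ :=
  coinMeasure.real {β | ∃ n, (V.run P w β n).state = .accept}

/-- The probability that the interaction of `P` and `V` on `w` results in rejection. -/
noncomputable def rejectProb (P : Prover α V.Γ) (w : List α) : ℝ :=
  coinMeasure.real {β | ∃ n, (V.run P w β n).state = .reject}

end Verifier

/-! ### Interactive proof systems -/

/-- The direction of communication: only from the prover to the verifier, or both ways. -/
inductive Communication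
  | oneWay
  | twoWay

/-- The strong and the weak definition of an interactive proof system. -/
inductive Criterion
  | strong
  | weak

/-- The provers that take part in the given kind of communication. -/
def Communication.provers (comm : Communication) (α : Type*) (Γ : Type) : Set (Prover α Γ) :=
  match comm with
  | .oneWay => {P | P.IsOneWay}
  | .twoWay => Set.univ

/-- What is required on an input outside the language, against a given prover: rejection with
probability at least `1 - ε` (strong), or acceptance with probability at most `ε` (weak). -/
def Criterion.Sound (crit : Criterion) {α : Type*} {k : ℕ} (V : Verifier α k) (ε : ℝ)
    (P : Prover α V.Γ) (w : List α) : Prop :=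
  match crit with
  | .strong => 1 - ε ≤ V.rejectProb P w
  | .weak => V.acceptProb P w ≤ ε

/-- `V`, together with some prover, is an interactive proof system for `L` with error
probability `ε`. -/
def IsProofSystem (comm : Communication) (crit : Criterion) {α : Type*} {k : ℕ}
    (V : Verifier α k) (L : Language α) (ε : ℝ) : Prop :=
  (∃ P ∈ comm.provers α V.Γ, ∀ w ∈ L, 1 - ε ≤ V.acceptProb P w) ∧
  (∀ w ∉ L, ∀ P ∈ comm.provers α V.Γ, crit.Sound V ε P w)

/-- The languages over `α` that have an interactive proof system, of the given kind and with an
error probability `ε < 1/2`, whose verifier is a finite automaton with `k ≥ 1` one-way heads that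
uses at most a constant number `r` of random bits. -/
def verifiable (comm : Communication) (crit : Criterion) (α : Type*) : Set (Language α) :=
  {L | ∃ k : ℕ, 1 ≤ k ∧ ∃ (V : Verifier α k) (r : ℕ), V.UsesAtMost r ∧
    ∃ ε : ℝ, 0 ≤ ε ∧ ε < 1 / 2 ∧ IsProofSystem comm crit V L ε}

end MultiheadVerifier

/-!
From automata to verifiers: the prover supplies an accepting computation of a `1nfa(k)`, transition
by transition, and a verifier without coins checks it.  Against the strong definition the verifier
must also halt on inputs outside the language, so the automaton is first freed of infinite
computations.  Heads can move only finitely often, hence it suffices to contract each series of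
transitions that move no head; since the two end-markers look the same, the automaton has to
remember which heads have left the left one in order to recognize such transitions.

From verifiers to automata: for a verifier that tosses at most `r` coins, an input is in the
language iff some prover makes it accept for more than half of the coin sequences of length `r + 1`.
An automaton with `k` heads for each of these sequences simulates all the runs in parallel and
guesses the responses.  The guesses must come from one prover: in each communication step, two runs
must receive the same response if they send the same symbol after the same communication (two-way),
or in any case (one-way).  If the runs communicate in lockstep, the automaton can check this with
finite memory, by keeping track of which runs have had the same communication so far.
-/

namespace MultiheadVerifier

/-! ### Runs of a verifier -/

namespace Verifier

variable {α : Type*} {k : ℕ} {V : Verifier α k}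

/-- Acceptance in the interaction of `V` with `P` on `w`, if the coins fall as in `β`. -/
def Accepts (P : Prover α V.Γ) (w : List α) (β : ℕ → Bool) : Prop :=
  ∃ n, (V.run P w β n).state = .accept

/-- Rejection in the interaction of `V` with `P` on `w`, if the coins fall as in `β`. -/
def Rejects (P : Prover α V.Γ) (w : List α) (β : ℕ → Bool) : Prop :=
  ∃ n, (V.run P w β n).state = .reject

variable {P P' : Prover α V.Γ} {w : List α} {β β' : ℕ → Bool} {n : ℕ}

theorem run_succ (P : Prover α V.Γ) (w : List α) (β : ℕ → Bool) (n : ℕ) :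
    V.run P w β (n + 1) = V.step P w β (V.run P w β n) :=
  Function.iterate_succ_apply' _ _ _

theorem step_of_halted {c : V.Snapshot} (hc : c.state = .accept ∨ c.state = .reject) :
    V.step P w β c = c := by
  rcases hc with hc | hc <;> simp only [step, hc]

theorem run_eq_of_halted {m : ℕ} (hmn : m ≤ n)
    (hm : (V.run P w β m).state = .accept ∨ (V.run P w β m).state = .reject) :
    V.run P w β n = V.run P w β m := by
  induction n, hmn using Nat.le_induction with
  | base => rfl
  | succ n _ ih => rw [run_succ, ih, step_of_halted hm]

theorem Accepts.state_ne_reject (h : V.Accepts P w β) (n : ℕ) :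
    (V.run P w β n).state ≠ .reject := by
  obtain ⟨m, hm⟩ := h
  intro hn
  have h_eq : V.run P w β n = V.run P w β m := by
    rcases le_total m n with hmn | hnm
    · exact run_eq_of_halted hmn (.inl hm)
    · exact (run_eq_of_halted hnm (.inr hn)).symm
  rw [h_eq, hm] at hn
  cases hn

theorem not_accepts_of_rejects (h : V.Rejects P w β) : ¬ V.Accepts P w β :=
  fun ha => h.elim ha.state_ne_reject

theorem length_history_le_run_succ (P : Prover α V.Γ) (w : List α) (β : ℕ → Bool) (n : ℕ) :
    (V.run P w β n).history.length ≤ (V.run P w β (n + 1)).history.length := by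
  have h_comm (h) (q) : h.length ≤ (V.communicate P w h q).2.length := by
    rw [communicate]
    split_ifs <;> simp
  rw [run_succ]
  rcases h : (V.run P w β n).state <;> simp only [step, h, h_comm, le_refl]

theorem heads_run_le (P : Prover α V.Γ) (w : List α) (β : ℕ → Bool) (n : ℕ) (i : Fin k) :
    (V.run P w β n).heads i ≤ w.length + 1 := by
  induction n with
  | zero => exact Nat.zero_le _
  | succ n ih =>
    rw [run_succ]
    rcases h : (V.run P w β n).state <;> simp only [step, h, ih] <;> exact min_le_right _ _

theorem communicate_congr_prover {N : ℕ} (hP : ∀ h s, h.length < N → P' w h s = P w h s)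
    {h : List (V.Γ × V.Γ)} {q : V.R ⊕ V.D} (hN : (V.communicate P w h q).2.length ≤ N) :
    V.communicate P' w h q = V.communicate P w h q := by
  by_cases h0 : V.msg q = V.null
  · simp only [communicate, if_pos h0]
  · simp only [communicate, if_neg h0, List.length_append, List.length_singleton] at hN ⊢
    rw [hP _ _ hN]

theorem run_congr_prover {N : ℕ} (hP : ∀ h s, h.length < N → P' w h s = P w h s)
    (hn : (V.run P w β n).history.length ≤ N) : V.run P' w β n = V.run P w β n := by
  induction n with
  | zero => rfl
  | succ n ih =>
    have ih := ih ((length_history_le_run_succ P w β n).trans hn)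
    rw [run_succ] at hn
    rw [run_succ, run_succ, ih]
    rcases hs : (V.run P w β n).state
    all_goals simp only [step, hs] at hn ⊢
    all_goals rw [communicate_congr_prover hP hn]

theorem usesAtMost_zero [IsEmpty V.R] : V.UsesAtMost 0 := by
  intro w P β n
  induction n with
  | zero => exact le_rfl
  | succ n ih =>
    rw [run_succ]
    rcases h : (V.run P w β n).state with q | _
    · exact isEmptyElim q
    all_goals simpa only [step, h] using ih

theorem UsesAtMost.run_congr_coins {r : ℕ} (hV : V.UsesAtMost r) (P : Prover α V.Γ) (w : List α)
    (hβ : ∀ j ≤ r, β j = β' j) (n : ℕ) : V.run P w β n = V.run P w β' n := by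
  induction n with
  | zero => rfl
  | succ n ih =>
    rw [run_succ, run_succ, ← ih]
    simp only [step, hβ _ (hV w P β n)]

end Verifier

/-! ### Acceptance probabilities -/

instance : IsProbabilityMeasure coinMeasure := by
  unfold coinMeasure
  infer_instance

theorem coinMeasure_real_prefix_eq {m : ℕ} (x : Fin m → Bool) :
    coinMeasure.real {β | (fun i : Fin m => β i) = x} = (1 / 2) ^ m := by
  have h_cylinder : {β : ℕ → Bool | (fun i : Fin m => β i) = x} =
      Set.pi (Finset.range m) fun j => if hj : j < m then {x ⟨j, hj⟩} else ∅ := by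
    ext β
    simp only [Set.mem_ofPred_eq, funext_iff, Set.mem_pi, Finset.coe_range, Set.mem_Iio]
    constructor
    · intro h j hj
      rw [dif_pos hj]
      exact h ⟨j, hj⟩
    · intro h i
      have := h i i.2
      rwa [dif_pos i.2] at this
  have h_coin (y : Bool) : (PMF.uniformOfFintype Bool).toMeasure {y} = 2⁻¹ := by
    rw [PMF.toMeasure_apply_singleton _ _ (measurableSet_singleton y)]
    simp
  rw [Measure.real, h_cylinder, coinMeasure, Measure.infinitePi_pi _ fun _ _ => .of_discrete,
    Finset.prod_congr rfl (g := fun _ => 2⁻¹)]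
  · simp
  · intro j hj
    rw [dif_pos (Finset.mem_range.1 hj), h_coin]

theorem coinMeasure_real_prefix_mem {m : ℕ} (S : Set (Fin m → Bool)) :
    coinMeasure.real {β | (fun i : Fin m => β i) ∈ S} = S.ncard * (1 / 2) ^ m := by
  classical
  have h_union : {β : ℕ → Bool | (fun i : Fin m => β i) ∈ S} =
      ⋃ x ∈ S.toFinset, {β | (fun i : Fin m => β i) = x} := by
    ext β
    simp
  rw [h_union, measureReal_biUnion_finset,
    Finset.sum_congr rfl fun x _ => coinMeasure_real_prefix_eq x, Finset.sum_const, nsmul_eq_mul,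
    Set.ncard_eq_toFinset_card']
  · intro x _ y _ hxy
    exact Set.disjoint_left.2 fun β hx hy => hxy (hx.symm.trans hy)
  · intro x _
    have h_meas : Measurable fun (β : ℕ → Bool) (i : Fin m) => β i := by fun_prop
    exact h_meas (measurableSet_singleton x)

/-- The outcomes of `r + 1` coin tosses: one more than a verifier that tosses at most `r` coins
can use, so that there is always a next coin. -/
abbrev Coins (r : ℕ) : Type := Fin (r + 1) → Bool

/-- The infinite sequence of coin tosses that repeats the given ones. -/
def Coins.periodic {r : ℕ} (b : Coins r) : ℕ → Bool := fun j => b (Fin.ofNat (r + 1) j)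

namespace Verifier

variable {α : Type*} {k r : ℕ} {V : Verifier α k} {P : Prover α V.Γ} {w : List α}

theorem UsesAtMost.run_periodic (hV : V.UsesAtMost r) (P : Prover α V.Γ) (w : List α)
    (β : ℕ → Bool) (n : ℕ) :
    V.run P w (Coins.periodic fun i : Fin (r + 1) => β i) n = V.run P w β n := by
  refine hV.run_congr_coins P w (fun j hj => ?_) n
  rw [Coins.periodic, Fin.val_ofNat, Nat.mod_eq_of_lt (Nat.lt_succ_of_le hj)]

theorem UsesAtMost.acceptProb_eq (hV : V.UsesAtMost r) (P : Prover α V.Γ) (w : List α) :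
    V.acceptProb P w =
      {b : Coins r | V.Accepts P w b.periodic}.ncard * (1 / 2) ^ (r + 1) := by
  rw [← coinMeasure_real_prefix_mem, acceptProb]
  simp only [Set.mem_ofPred_eq, Accepts, hV.run_periodic]

theorem UsesAtMost.half_lt_acceptProb_iff (hV : V.UsesAtMost r) :
    1 / 2 < V.acceptProb P w ↔ 2 ^ r < {b : Coins r | V.Accepts P w b.periodic}.ncard := by
  rw [hV.acceptProb_eq, ← @Nat.cast_lt ℝ, one_div, inv_pow, ← div_eq_mul_inv,
    lt_div_iff₀ (by positivity), pow_succ]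
  push_cast
  ring_nf

theorem UsesAtMost.measurableSet_accepts (hV : V.UsesAtMost r) :
    MeasurableSet {β | V.Accepts P w β} := by
  have h_meas : Measurable fun (β : ℕ → Bool) (i : Fin (r + 1)) => β i := by fun_prop
  have := h_meas (.of_discrete (s := {b : Coins r | V.Accepts P w b.periodic}))
  simpa only [Set.preimage_ofPred_eq, Accepts, hV.run_periodic] using this

theorem UsesAtMost.acceptProb_add_rejectProb_le_one (hV : V.UsesAtMost r) (P : Prover α V.Γ)
    (w : List α) : V.acceptProb P w + V.rejectProb P w ≤ 1 := by
  have h_disjoint : Disjoint {β | V.Rejects P w β} {β | V.Accepts P w β} :=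
    Set.disjoint_left.2 fun _ => not_accepts_of_rejects
  rw [add_comm]
  exact (measureReal_union h_disjoint hV.measurableSet_accepts).symm.trans_le measureReal_le_one

theorem UsesAtMost.acceptProb_le_of_sound (hV : V.UsesAtMost r) {crit : Criterion} {ε : ℝ}
    (h : crit.Sound V ε P w) : V.acceptProb P w ≤ ε := by
  cases crit with
  | strong =>
    have h_reject : 1 - ε ≤ V.rejectProb P w := h
    linarith [hV.acceptProb_add_rejectProb_le_one P w]
  | weak => exact h

theorem UsesAtMost.mem_iff_of_isProofSystem (hV : V.UsesAtMost r) {comm : Communication}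
    {crit : Criterion} {L : Language α} {ε : ℝ} (hε : ε < 1 / 2)
    (hL : IsProofSystem comm crit V L ε) :
    w ∈ L ↔ ∃ P ∈ comm.provers α V.Γ, 1 / 2 < V.acceptProb P w := by
  obtain ⟨⟨P, hP, h_complete⟩, h_sound⟩ := hL
  constructor
  · exact fun hw => ⟨P, hP, by linarith [h_complete w hw]⟩
  · rintro ⟨P', hP', h_half⟩
    by_contra hw
    linarith [hV.acceptProb_le_of_sound (h_sound w hw P' hP')]

theorem acceptProb_eq_one (h : ∀ β, V.Accepts P w β) : V.acceptProb P w = 1 := by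
  have h_univ : {β | ∃ n, (V.run P w β n).state = .accept} = Set.univ := Set.eq_univ_of_forall h
  rw [acceptProb, h_univ, probReal_univ]

theorem sound_of_forall_rejects (crit : Criterion) (h : ∀ β, V.Rejects P w β) :
    crit.Sound V 0 P w := by
  cases crit with
  | strong =>
    have h_univ : {β | ∃ n, (V.run P w β n).state = .reject} = Set.univ :=
      Set.eq_univ_of_forall h
    rw [Criterion.Sound, rejectProb, h_univ, probReal_univ, sub_zero]
  | weak =>
    have h_empty : {β | ∃ n, (V.run P w β n).state = .accept} = ∅ :=
      Set.eq_empty_of_forall_notMem fun β => not_accepts_of_rejects (h β)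
    rw [Criterion.Sound, acceptProb, h_empty, measureReal_empty]

end Verifier

/-! ### From automata to verifiers -/

section Heads

variable {α : Type*} {k : ℕ} {w : List α} {p : Fin k → ℕ}

theorem tape_eq_none_iff {n : ℕ} (hn : n ≤ w.length + 1) :
    tape w n = none ↔ n = 0 ∨ n = w.length + 1 := by
  cases n with
  | zero => simp only [tape, true_or]
  | succ n =>
    simp only [tape, List.getElem?_eq_none_iff]
    lia

theorem move_le (w : List α) (p : Fin k → ℕ) (d : Fin k → Fin 2) (i : Fin k) :
    move w p d i ≤ w.length + 1 :=
  min_le_right _ _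

theorem move_zero (hp : ∀ i, p i ≤ w.length + 1) : move w p 0 = p :=
  funext fun i => min_eq_left (hp i)

theorem le_move (hp : ∀ i, p i ≤ w.length + 1) (d : Fin k → Fin 2) : p ≤ move w p d :=
  fun i => le_min (Nat.le_add_right _ _) (hp i)

theorem support_move (w : List α) (p : Fin k → ℕ) (d : Fin k → Fin 2) :
    (move w p d).support = p.support ∪ d.support := by
  ext i
  simp only [Function.mem_support, Set.mem_union, move, ne_eq, ← Fin.val_eq_zero_iff]
  lia

/-- The instruction `d` moves no head, if `s` is the tuple of scanned symbols and `m` is the set of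
the heads that have left the left end-marker.  The scanned symbols alone do not tell, because the
end-markers look the same. -/
def IsIdle (m : Set (Fin k)) (s : Fin k → Option α) (d : Fin k → Fin 2) : Prop :=
  ∀ i, d i = 0 ∨ i ∈ m ∧ s i = none

theorem isIdle_support_iff (hp : ∀ i, p i ≤ w.length + 1) (d : Fin k → Fin 2) :
    IsIdle p.support (scan w p) d ↔ move w p d = p := by
  rw [funext_iff]
  refine forall_congr' fun i => ?_
  have := hp i
  simp only [scan, move, Function.mem_support, tape_eq_none_iff this, ← Fin.val_eq_zero_iff]
  lia

end Heads

namespace OneWayNFA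

attribute [instance] OneWayNFA.finQ

variable {α : Type*} {k : ℕ} {M : OneWayNFA α k} {w : List α}

variable (M) in
/-- Reachability of a configuration from the start. -/
def Reachable (w : List α) : M.Q × (Fin k → ℕ) → Prop :=
  Relation.ReflTransGen (M.Step w) (M.start, fun _ => 0)

variable (M) in
/-- No computation on `w` from the configuration `c` goes on forever. -/
def HaltsFrom (w : List α) : M.Q × (Fin k → ℕ) → Prop :=
  Acc fun c' c => M.Step w c c'

variable (M) in
/-- Reachability by transitions that move no head, for the heads `m` off the left end-marker and
the scanned symbols `s`. -/
def IdleReachable (m : Set (Fin k)) (s : Fin k → Option α) : M.Q → M.Q → Prop :=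
  Relation.ReflTransGen fun q q' => ∃ d, IsIdle m s d ∧ (q', d) ∈ M.δ q s

variable (M) in
/-- An automaton for the language of `M` without infinite computations.  It does a series of idle
transitions of `M` and the next transition that moves a head at once, or else halts in the
accepting state `none`.  Its states keep the set of the heads that have left the left
end-marker. -/
def eager : OneWayNFA α k where
  Q := Option (M.Q × Set (Fin k))
  start := some (M.start, ∅)
  accept := {none}
  δ x s := {y | ∃ u ∈ x, ∃ q, M.IdleReachable u.2 s u.1 q ∧
    (q ∈ M.accept ∧ y = (none, 0) ∨
      ∃ t ∈ M.δ q s, ¬ IsIdle u.2 s t.2 ∧ y = (some (t.1, u.2 ∪ t.2.support), t.2))}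

theorem IdleReachable.reflTransGen {p : Fin k → ℕ} (hp : ∀ i, p i ≤ w.length + 1) {q q' : M.Q}
    (h : M.IdleReachable p.support (scan w p) q q') :
    Relation.ReflTransGen (M.Step w) (q, p) (q', p) :=
  Relation.ReflTransGen.lift (fun q => (q, p))
    (fun _ _ ⟨d, hd, hδ⟩ => ⟨d, hδ, ((isIdle_support_iff hp d).1 hd).symm⟩) _ _ h

theorem not_step_eager_none {p : Fin k → ℕ} {c : M.eager.Q × (Fin k → ℕ)} :
    ¬ M.eager.Step w (none, p) c := by
  rintro ⟨d, ⟨u, hu, -⟩, -⟩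
  cases hu

theorem step_eager_some_iff {p : Fin k → ℕ} (hp : ∀ i, p i ≤ w.length + 1) {q : M.Q}
    {c : M.eager.Q × (Fin k → ℕ)} :
    M.eager.Step w (some (q, p.support), p) c ↔
      ∃ q', M.IdleReachable p.support (scan w p) q q' ∧
        (q' ∈ M.accept ∧ c = (none, p) ∨
          ∃ t ∈ M.δ q' (scan w p), move w p t.2 ≠ p ∧
            c = (some (t.1, (move w p t.2).support), move w p t.2)) := by
  obtain ⟨x, p'⟩ := c
  constructor
  · rintro ⟨d, ⟨u, hu, q', hq', h⟩, hp'⟩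
    cases Option.mem_some_iff.1 hu
    obtain rfl : p' = move w p d := hp'
    refine ⟨q', hq', h.imp ?_ ?_⟩
    · rintro ⟨ha, heq⟩
      cases heq
      exact ⟨ha, congrArg (Prod.mk none) (move_zero hp)⟩
    · rintro ⟨t, ht, h_idle, heq⟩
      cases heq
      exact ⟨t, ht, mt (isIdle_support_iff hp _).2 h_idle, by simp only [support_move]; rfl⟩
  · rintro ⟨q', hq', ⟨ha, heq⟩ | ⟨t, ht, h_move, heq⟩⟩
    · cases heq
      exact ⟨0, ⟨_, rfl, q', hq', .inl ⟨ha, rfl⟩⟩, (move_zero hp).symm⟩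
    · cases heq
      exact ⟨t.2, ⟨_, rfl, q', hq', .inr ⟨t, ht, mt (isIdle_support_iff hp _).1 h_move,
        by simp only [support_move]; rfl⟩⟩, rfl⟩

theorem eager_sound {c : M.eager.Q × (Fin k → ℕ)} (h : M.eager.Reachable w c) :
    (∀ i, c.2 i ≤ w.length + 1) ∧
      ((c.1 = none ∧ w ∈ M.language) ∨
        ∃ q, c.1 = some (q, c.2.support) ∧ M.Reachable w (q, c.2)) := by
  induction h with
  | refl =>
    exact ⟨fun _ => Nat.zero_le _, .inr ⟨M.start, by simp [eager], .refl⟩⟩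
  | @tail c c' _ hcc' ih =>
    obtain ⟨x, p⟩ := c
    obtain ⟨hp, ⟨hx, -⟩ | ⟨q, hx, hq⟩⟩ := ih
    · obtain rfl : x = none := hx
      exact absurd hcc' not_step_eager_none
    obtain rfl : x = some (q, p.support) := hx
    obtain ⟨q', hq', ⟨ha, rfl⟩ | ⟨t, ht, -, rfl⟩⟩ := (step_eager_some_iff hp).1 hcc'
    · exact ⟨hp, .inl ⟨rfl, q', ha, p, hq.trans (hq'.reflTransGen hp)⟩⟩
    · exact ⟨move_le w p t.2, .inr ⟨t.1, rfl, (hq.trans (hq'.reflTransGen hp)).tail ⟨t.2, ht, rfl⟩⟩⟩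

theorem eager_complete {c : M.Q × (Fin k → ℕ)} (h : M.Reachable w c) :
    (∀ i, c.2 i ≤ w.length + 1) ∧
      ∃ q, M.eager.Reachable w (some (q, c.2.support), c.2) ∧
        M.IdleReachable c.2.support (scan w c.2) q c.1 := by
  induction h with
  | refl =>
    refine ⟨fun _ => Nat.zero_le _, M.start, ?_, .refl⟩
    rw [Function.support_fun_zero]
    exact .refl
  | @tail c c' _ hcc' ih =>
    obtain ⟨q₁, p⟩ := c
    obtain ⟨q₂, p'⟩ := c'
    obtain ⟨hp, q, hq, h_idle⟩ := ih
    obtain ⟨d, hd, rfl : p' = move w p d⟩ := hcc'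
    refine ⟨move_le w p d, ?_⟩
    by_cases h_move : move w p d = p
    · simp only [h_move]
      exact ⟨q, hq, h_idle.tail ⟨d, (isIdle_support_iff hp d).2 h_move, hd⟩⟩
    · exact ⟨q₂, hq.tail ((step_eager_some_iff hp).2
        ⟨q₁, h_idle, .inr ⟨(q₂, d), hd, h_move, rfl⟩⟩), .refl⟩

variable (M) in
theorem language_eager : M.eager.language = M.language := by
  ext w
  constructor
  · rintro ⟨_, rfl, p, hp⟩
    obtain ⟨-, ⟨-, hw⟩ | ⟨q, hq, -⟩⟩ := eager_sound hp
    · exact hw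
    · cases hq
  · rintro ⟨a, ha, p, hp⟩
    obtain ⟨h_le, q, hq, h_idle⟩ := eager_complete hp
    exact ⟨none, rfl, p, hq.tail ((step_eager_some_iff h_le).2 ⟨a, h_idle, .inl ⟨ha, rfl⟩⟩)⟩

theorem haltsFrom_eager {p : Fin k → ℕ} (hp : ∀ i, p i ≤ w.length + 1) (q : M.Q) :
    M.eager.HaltsFrom w (some (q, p.support), p) := by
  have h_wf : (Set.Iic fun _ : Fin k => w.length + 1).WellFoundedOn (· > ·) :=
    (Set.finite_Iic _).wellFoundedOn
  revert q
  refine h_wf.induction (P := fun p => ∀ q, M.eager.HaltsFrom w (some (q, p.support), p)) hp ?_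
  intro p hp ih q
  refine .intro _ fun c hc => ?_
  obtain ⟨q', -, ⟨-, rfl⟩ | ⟨t, -, h_move, rfl⟩⟩ := (step_eager_some_iff hp).1 hc
  · exact .intro _ fun _ h => absurd h not_step_eager_none
  · exact ih _ (move_le w p t.2) (lt_of_le_of_ne (le_move hp t.2) h_move.symm) t.1

variable (M w) in
theorem haltsFrom_start_eager : M.eager.HaltsFrom w (M.eager.start, fun _ => 0) := by
  have := haltsFrom_eager (w := w) (p := fun _ : Fin k => 0) (fun _ => Nat.zero_le _) M.start
  rwa [Function.support_fun_zero] at this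

open Classical in
variable (M) in
/-- The verifier without coin tosses that simulates `M` and asks the prover for the next transition
in each step.  It rejects responses that are not transitions of `M`.  Any message but the null
symbol `none` would do. -/
noncomputable def guided : Verifier α k where
  R := Empty
  D := M.Q
  Γ := Option (M.Q × (Fin k → Fin 2))
  null := none
  start := .inr M.start
  msg _ := some (M.start, 0)
  δcoin q := q.elim
  δdet q s g :=
    if q ∈ M.accept then (.accept, 0)
    else match g with
      | none => (.reject, 0)
      | some t => if t ∈ M.δ q s then (.det t.1, t.2) else (.reject, 0)

variable (M) in
/-- The symbol that `M.guided` sends in each step. -/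
def query : M.guided.Γ := some (M.start, 0)

variable {P : Prover α M.guided.Γ} {β : ℕ → Bool} {c : M.Q × (Fin k → ℕ)} {n : ℕ}

theorem δdet_guided_of_mem_accept {q : M.Q} (hq : q ∈ M.accept) (s : Fin k → Option α)
    (g : M.guided.Γ) : M.guided.δdet q s g = (.accept, 0) :=
  if_pos hq

theorem δdet_guided_some {q : M.Q} (hq : q ∉ M.accept) {s : Fin k → Option α}
    {t : M.Q × (Fin k → Fin 2)} (ht : t ∈ M.δ q s) :
    M.guided.δdet q s (some t) = (.det t.1, t.2) :=
  (if_neg hq).trans (if_pos ht)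

theorem δdet_guided_eq_reject {q : M.Q} (hq : q ∉ M.accept) {s : Fin k → Option α}
    {g : M.guided.Γ} (hg : ∀ t ∈ M.δ q s, g ≠ some t) :
    M.guided.δdet q s g = (.reject, 0) :=
  (if_neg hq).trans <| match g with
    | none => rfl
    | some t => if_neg fun ht => hg t ht rfl

theorem run_succ_guided {q : M.guided.D} (h_state : (M.guided.run P w β n).state = .det q)
    {g : M.guided.Γ} (hg : P w (M.guided.run P w β n).history M.query = g) :
    M.guided.run P w β (n + 1) =
      { state := (M.guided.δdet q (scan w (M.guided.run P w β n).heads) g).1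
        heads := move w (M.guided.run P w β n).heads
          (M.guided.δdet q (scan w (M.guided.run P w β n).heads) g).2
        tossed := (M.guided.run P w β n).tossed
        history := (M.guided.run P w β n).history ++ [(M.query, g)] } := by
  have h_query : M.guided.msg (.inr q) ≠ M.guided.null := Option.some_ne_none _
  rw [Verifier.run_succ, ← hg]
  simp only [Verifier.step, h_state, Verifier.communicate, if_neg h_query]
  rfl

theorem accepts_guided_of_mem_accept {q : M.Q} (hq : q ∈ M.accept)
    (h_state : (M.guided.run P w β n).state = .det q) : M.guided.Accepts P w β := by
  refine ⟨n + 1, ?_⟩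
  rw [run_succ_guided h_state rfl]
  exact congrArg Prod.fst (δdet_guided_of_mem_accept hq _ _)

theorem rejects_guided_of_response {q : M.Q} (hq : q ∉ M.accept)
    (h_state : (M.guided.run P w β n).state = .det q)
    (h_response : ∀ t ∈ M.δ q (scan w (M.guided.run P w β n).heads),
      P w (M.guided.run P w β n).history M.query ≠ some t) : M.guided.Rejects P w β := by
  refine ⟨n + 1, ?_⟩
  rw [run_succ_guided h_state rfl]
  exact congrArg Prod.fst (δdet_guided_eq_reject hq h_response)

theorem run_succ_guided_of_response {q : M.Q} (hq : q ∉ M.accept)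
    (h_state : (M.guided.run P w β n).state = .det q) {t : M.Q × (Fin k → Fin 2)}
    (ht : t ∈ M.δ q (scan w (M.guided.run P w β n).heads))
    (h_response : P w (M.guided.run P w β n).history M.query = some t) :
    (M.guided.run P w β (n + 1)).state = .det t.1 ∧
      (M.guided.run P w β (n + 1)).heads = move w (M.guided.run P w β n).heads t.2 := by
  rw [run_succ_guided h_state h_response, δdet_guided_some hq ht]
  exact ⟨rfl, rfl⟩

theorem rejects_guided_of_haltsFrom (hw : w ∉ M.language) (hc : M.HaltsFrom w c)
    (h_reach : M.Reachable w c) (h_state : (M.guided.run P w β n).state = .det c.1)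
    (h_heads : (M.guided.run P w β n).heads = c.2) : M.guided.Rejects P w β := by
  induction hc generalizing n with
  | intro c _ ih =>
    have hq : c.1 ∉ M.accept := fun ha => hw ⟨c.1, ha, c.2, h_reach⟩
    by_cases h : ∃ t ∈ M.δ c.1 (scan w c.2), P w (M.guided.run P w β n).history M.query = some t
    · obtain ⟨t, ht, h_response⟩ := h
      rw [← h_heads] at ht
      obtain ⟨h_state', h_heads'⟩ := run_succ_guided_of_response hq h_state ht h_response
      rw [h_heads] at ht h_heads'
      have h_step : M.Step w c (t.1, move w c.2 t.2) := ⟨t.2, ht, rfl⟩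
      exact ih _ h_step (h_reach.tail h_step) h_state' h_heads'
    · push Not at h
      exact rejects_guided_of_response hq h_state (h_heads ▸ h)

theorem exists_accepting_responses {c' : M.Q × (Fin k → ℕ)}
    (h : Relation.ReflTransGen (M.Step w) c c') (hc' : c'.1 ∈ M.accept) (N : ℕ) :
    ∃ g : ℕ → M.guided.Γ, ∀ P β n, (∀ h s, N ≤ h.length → P w h s = g h.length) →
      (M.guided.run P w β n).state = .det c.1 → (M.guided.run P w β n).heads = c.2 →
      (M.guided.run P w β n).history.length = N → M.guided.Accepts P w β := by
  induction h using Relation.ReflTransGen.head_induction_on generalizing N with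
  | refl =>
    exact ⟨fun _ => M.guided.null, fun _ _ _ _ h_state _ _ =>
      accepts_guided_of_mem_accept hc' h_state⟩
  | @head c c₁ h_step _ ih =>
    obtain ⟨d, hd, h_move⟩ := h_step
    obtain ⟨g, hg⟩ := ih (N + 1)
    refine ⟨Function.update g N (some (c₁.1, d)), fun P β n hP h_state h_heads h_length => ?_⟩
    by_cases hq : c.1 ∈ M.accept
    · exact accepts_guided_of_mem_accept hq h_state
    have h_response : P w (M.guided.run P w β n).history M.query = some (c₁.1, d) :=
      (hP _ _ h_length.ge).trans (h_length ▸ Function.update_self ..)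
    obtain ⟨h_state', h_heads'⟩ :=
      run_succ_guided_of_response hq h_state (h_heads ▸ hd) h_response
    refine hg P β (n + 1) (fun h s hN => ?_) h_state' ?_ ?_
    · exact (hP h s (Nat.le_of_succ_le hN)).trans (Function.update_of_ne (Nat.ne_of_gt hN) ..)
    · rw [h_heads', h_heads, h_move]
    · rw [run_succ_guided h_state rfl, ← h_length]
      exact List.length_append

theorem isProofSystem_guided (comm : Communication) (crit : Criterion)
    (h_halts : ∀ w, M.HaltsFrom w (M.start, fun _ => 0)) :
    IsProofSystem comm crit M.guided M.language 0 := by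
  have h_responses (w) (hw : w ∈ M.language) : ∃ g : ℕ → M.guided.Γ, ∀ (P : Prover α M.guided.Γ) β,
      (∀ h s, P w h s = g h.length) → M.guided.Accepts P w β := by
    obtain ⟨q, hq, p, h⟩ := hw
    obtain ⟨g, hg⟩ := exists_accepting_responses h hq 0
    exact ⟨g, fun P β hP => hg P β 0 (fun h s _ => hP h s) rfl rfl rfl⟩
  have : Nonempty M.guided.Γ := ⟨M.guided.null⟩
  choose! g hg using h_responses
  constructor
  · refine ⟨fun w h _ => g w h.length, ?_, fun w hw => ?_⟩
    · cases comm with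
      | oneWay => exact ⟨g, fun _ _ _ => rfl⟩
      | twoWay => trivial
    · rw [Verifier.acceptProb_eq_one fun β => hg w hw _ β fun _ _ => rfl, sub_zero]
  · exact fun w hw P _ => Verifier.sound_of_forall_rejects crit fun β =>
      rejects_guided_of_haltsFrom (n := 0) hw (h_halts w) .refl rfl rfl

end OneWayNFA

theorem classOneNFA_subset_verifiable (comm : Communication) (crit : Criterion) (α : Type*)
    {k : ℕ} (hk : 1 ≤ k) : classOneNFA α k ⊆ verifiable comm crit α := by
  rintro _ ⟨M, rfl⟩
  have : IsEmpty M.eager.guided.R := inferInstanceAs (IsEmpty Empty)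
  rw [← M.language_eager]
  exact ⟨k, hk, M.eager.guided, 0, Verifier.usesAtMost_zero, 0, le_rfl, by norm_num,
    OneWayNFA.isProofSystem_guided comm crit M.haltsFrom_start_eager⟩

/-! ### From verifiers to automata -/

theorem Communication.mem_provers_iff {α : Type*} {Γ : Type} [Nonempty Γ] {comm : Communication}
    {P : Prover α Γ} :
    P ∈ comm.provers α Γ ↔ ∀ w h s h' s', h.length = h'.length →
      (comm = .twoWay → h = h' ∧ s = s') → P w h s = P w h' s' := by
  cases comm with
  | oneWay =>
    constructor
    · rintro ⟨c, hc⟩ w h s h' s' h_length -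
      rw [hc, hc, h_length]
    · intro hP
      obtain ⟨g⟩ := ‹Nonempty Γ›
      refine ⟨fun w i => P w (List.replicate i (g, g)) g, fun w h s => hP _ _ _ _ _ ?_ nofun⟩
      rw [List.length_replicate]
  | twoWay =>
    refine iff_of_true trivial fun w h s h' s' _ h_eq => ?_
    obtain ⟨rfl, rfl⟩ := h_eq rfl
    rfl

instance {R D : Type} [Finite R] [Finite D] : Finite (VState R D) := by
  refine Finite.of_surjective (α := (R ⊕ D) ⊕ Bool)
    (Sum.elim (Sum.elim .coin .det) fun b => if b then .accept else .reject) fun s => ?_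
  rcases s with q | q | _ | _
  · exact ⟨.inl (.inl q), rfl⟩
  · exact ⟨.inl (.inr q), rfl⟩
  · exact ⟨.inr true, rfl⟩
  · exact ⟨.inr false, rfl⟩

namespace Verifier

attribute [instance] Verifier.finR Verifier.finD Verifier.finΓ

variable {α : Type*} {k r : ℕ} {V : Verifier α k}

/-- The communication symbol of a non-halting state. -/
def signal : VState V.R V.D → Option V.Γ
  | .coin q => some (V.msg (.inl q))
  | .det q => some (V.msg (.inr q))
  | .accept => none
  | .reject => none

/-- In the state `s`, the verifier is about to make a move without communication. -/
def Silent (s : VState V.R V.D) : Prop := V.signal s = some V.null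

/-- In the state `s`, the verifier is about to send the symbol `m`. -/
def Sends (s : VState V.R V.D) (m : V.Γ) : Prop := V.signal s = some m ∧ m ≠ V.null

theorem Sends.signal_ne_none {s : VState V.R V.D} {m : V.Γ} (h : V.Sends s m) :
    V.signal s ≠ none :=
  h.1 ▸ Option.some_ne_none m

theorem Silent.signal_ne_none {s : VState V.R V.D} (h : V.Silent s) : V.signal s ≠ none :=
  h.trans_ne (Option.some_ne_none _)

theorem signal_eq_none_iff {s : VState V.R V.D} :
    V.signal s = none ↔ s = .accept ∨ s = .reject := by
  cases s <;> simp [signal]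

theorem exists_sends {s : VState V.R V.D} (h : V.signal s ≠ none) (hs : ¬ V.Silent s) :
    ∃ m, V.Sends s m := by
  obtain ⟨m, hm⟩ := Option.ne_none_iff_exists'.1 h
  exact ⟨m, hm, fun h_null => hs (hm.trans (congrArg some h_null))⟩

/-- The state of a simulation of `V`: the state of `V` and the number of coins tossed so far, modulo
the number of available coins. -/
abbrev Sim (V : Verifier α k) (r : ℕ) : Type := VState V.R V.D × Fin (r + 1)

/-- The simulation state that corresponds to a snapshot. -/
def Snapshot.sim (r : ℕ) (c : V.Snapshot) : V.Sim r := (c.state, Fin.ofNat (r + 1) c.tossed)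

/-- The transition of a simulation with the coins `b`, if `s` are the scanned symbols and `g` is the
content of the communication cell. -/
def next (b : Coins r) (ℓ : V.Sim r) (s : Fin k → Option α) (g : V.Γ) :
    V.Sim r × (Fin k → Fin 2) :=
  match ℓ.1 with
  | .coin q => (((V.δcoin q s g (b ℓ.2)).1, ℓ.2 + 1), (V.δcoin q s g (b ℓ.2)).2)
  | .det q => (((V.δdet q s g).1, ℓ.2), (V.δdet q s g).2)
  | .accept => (ℓ, 0)
  | .reject => (ℓ, 0)

theorem next_of_signal_eq_none {ℓ : V.Sim r} (hℓ : V.signal ℓ.1 = none) (b : Coins r)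
    (s : Fin k → Option α) (g : V.Γ) : V.next b ℓ s g = (ℓ, 0) := by
  rcases signal_eq_none_iff.1 hℓ with h | h <;> simp only [next, h]

theorem step_eq_next {c : V.Snapshot} {m : V.Γ} (hc : V.signal c.state = some m)
    (P : Prover α V.Γ) (w : List α) (b : Coins r) {g : V.Γ} {h : List (V.Γ × V.Γ)}
    (hgh : (m = V.null ∧ g = V.null ∧ h = c.history) ∨
      (m ≠ V.null ∧ g = P w c.history m ∧ h = c.history ++ [(m, g)])) :
    (V.step P w b.periodic c).sim r = (V.next b (c.sim r) (scan w c.heads) g).1 ∧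
      (V.step P w b.periodic c).heads =
        move w c.heads (V.next b (c.sim r) (scan w c.heads) g).2 ∧
      (V.step P w b.periodic c).history = h := by
  have h_comm (q) (hq : V.msg q = m) : V.communicate P w c.history q = (g, h) := by
    rw [communicate, hq]
    rcases hgh with ⟨hm, rfl, rfl⟩ | ⟨hm, rfl, rfl⟩
    · rw [if_pos hm]
    · rw [if_neg hm]
  have h_ofNat : Fin.ofNat (r + 1) (c.tossed + 1) = Fin.ofNat (r + 1) c.tossed + 1 := by
    ext
    simp [Fin.val_add]
  rcases hs : c.state with q | q | _ | _ <;> rw [hs] at hc <;> cases hc <;>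
    simp only [step, hs, h_comm _ rfl, Snapshot.sim, next, Coins.periodic, h_ofNat, and_self]

/-- After `n` steps of the interaction with `P` and the coins `b`, the simulation is in the state
`ℓ` with the heads at `p`, and there have been at most `N` communication steps, exactly `N` of them
if the state is not a halting state. -/
structure Tracks (P : Prover α V.Γ) (w : List α) (b : Coins r) (N n : ℕ) (ℓ : V.Sim r)
    (p : Fin k → ℕ) : Prop where
  sim_eq : (V.run P w b.periodic n).sim r = ℓ
  heads_eq : (V.run P w b.periodic n).heads = p
  length_le : (V.run P w b.periodic n).history.length ≤ N
  length_eq : V.signal ℓ.1 ≠ none → (V.run P w b.periodic n).history.length = N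

section Tracks

variable {P : Prover α V.Γ} {w : List α} {b : Coins r} {N n : ℕ} {ℓ : V.Sim r} {p : Fin k → ℕ}

theorem Tracks.state_eq (h : Tracks P w b N n ℓ p) : (V.run P w b.periodic n).state = ℓ.1 :=
  congrArg Prod.fst h.sim_eq

theorem Tracks.wait (h : Tracks P w b N n ℓ p) : Tracks P w b N n ℓ (move w p 0) := by
  rw [move_zero fun i => h.heads_eq ▸ heads_run_le P w b.periodic n i]
  exact h

theorem Tracks.succ_of_halted (h : Tracks P w b N n ℓ p) (hℓ : V.signal ℓ.1 = none) :
    Tracks P w b (N + 1) n ℓ p :=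
  ⟨h.sim_eq, h.heads_eq, h.length_le.trans (Nat.le_succ N), absurd hℓ⟩

theorem Tracks.lt_of_accept (h : Tracks P w b N n ℓ p) (hℓ : ℓ.1 ≠ .accept) {T : ℕ}
    (hT : (V.run P w b.periodic T).state = .accept) : n < T := by
  by_contra! hle
  rw [← h.state_eq, run_eq_of_halted hle (.inl hT)] at hℓ
  exact hℓ hT

theorem Tracks.silent (h : Tracks P w b N n ℓ p) (hℓ : V.Silent ℓ.1) :
    Tracks P w b N (n + 1) (V.next b ℓ (scan w p) V.null).1
        (move w p (V.next b ℓ (scan w p) V.null).2) ∧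
      (V.run P w b.periodic (n + 1)).history = (V.run P w b.periodic n).history := by
  obtain ⟨h_sim, h_heads, h_history⟩ :=
    step_eq_next (h.state_eq ▸ hℓ) P w b (.inl ⟨rfl, rfl, rfl⟩)
  rw [← run_succ] at h_sim h_heads h_history
  rw [h.sim_eq, h.heads_eq] at h_sim h_heads
  have h_length := (congrArg List.length h_history).trans (h.length_eq hℓ.signal_ne_none)
  exact ⟨⟨h_sim, h_heads, h_length.le, fun _ => h_length⟩, h_history⟩

theorem Tracks.sends (h : Tracks P w b N n ℓ p) {m g : V.Γ} (hℓ : V.Sends ℓ.1 m)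
    (hg : g = P w (V.run P w b.periodic n).history m) :
    Tracks P w b (N + 1) (n + 1) (V.next b ℓ (scan w p) g).1
        (move w p (V.next b ℓ (scan w p) g).2) ∧
      (V.run P w b.periodic (n + 1)).history =
        (V.run P w b.periodic n).history ++ [(m, g)] := by
  obtain ⟨h_sim, h_heads, h_history⟩ :=
    step_eq_next (h.state_eq ▸ hℓ.1) P w b (.inr ⟨hℓ.2, hg, rfl⟩)
  rw [← run_succ] at h_sim h_heads h_history
  rw [h.sim_eq, h.heads_eq] at h_sim h_heads
  have h_length : (V.run P w b.periodic (n + 1)).history.length = N + 1 := by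
    rw [h_history, List.length_append, h.length_eq hℓ.signal_ne_none, List.length_singleton]
  exact ⟨⟨h_sim, h_heads, h_length.le, fun _ => h_length⟩, h_history⟩

end Tracks

instance : Nonempty V.Γ := ⟨V.null⟩

/-- The joint state of the simulations for all outcomes of the coin tosses, with the relation of
having had the same communication so far.  The simulations that have been given up are in the
rejecting state. -/
structure Joint (V : Verifier α k) (r : ℕ) where
  sims : Coins r → V.Sim r
  same : Coins r → Coins r → Prop

instance : Finite (V.Joint r) :=
  Finite.of_injective (fun x => (x.sims, x.same)) fun ⟨_, _⟩ ⟨_, _⟩ h => by cases h; rfl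

open Classical in
/-- The joint transition in which each silent simulation makes a move, and the others wait. -/
noncomputable def silentRound (x : V.Joint r) (s : Coins r → Fin k → Option α) :
    V.Joint r × (Coins r → Fin k → Fin 2) :=
  let y b := if V.Silent (x.sims b).1 then V.next b (x.sims b) (s b) V.null else (x.sims b, 0)
  (⟨fun b => (y b).1, x.same⟩, fun b => (y b).2)

open Classical in
/-- The joint transition in which each communicating simulation makes a move, with the responses
`f`.  The silent simulations, which would fall behind in the number of communication steps, are
given up; this loses no accepting run if silent rounds have been preferred so far. -/
noncomputable def commRound (x : V.Joint r) (s : Coins r → Fin k → Option α) (f : Coins r → V.Γ) :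
    V.Joint r × (Coins r → Fin k → Fin 2) :=
  let y b := if V.Silent (x.sims b).1 then ((.reject, 0), 0) else V.next b (x.sims b) (s b) (f b)
  (⟨fun b => (y b).1,
    fun b b' => x.same b b' ∧ V.signal (x.sims b).1 = V.signal (x.sims b').1⟩, fun b => (y b).2)

/-- The responses `f` may all come from one prover of the given kind. -/
def Compatible (comm : Communication) (x : V.Joint r) (f : Coins r → V.Γ) : Prop :=
  ∀ b b' m m', V.Sends (x.sims b).1 m → V.Sends (x.sims b').1 m' →
    (comm = .twoWay → x.same b b' ∧ m = m') → f b = f b'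

/-- The transitions available to the automaton that runs all simulations in parallel, when it is in
the joint state `x` and the simulations scan the symbols `s`. -/
inductive Round (comm : Communication) (x : V.Joint r) (s : Coins r → Fin k → Option α) :
    V.Joint r × (Coins r → Fin k → Fin 2) → Prop
  | silent : Round comm x s (silentRound x s)
  | comm (f : Coins r → V.Γ) (hf : Compatible comm x f) : Round comm x s (commRound x s f)

/-- One step of the joint simulation on input `w`; a configuration is a joint state with the head
positions of each simulation. -/
inductive RoundStep (comm : Communication) (w : List α) :
    V.Joint r × (Coins r → Fin k → ℕ) → V.Joint r × (Coins r → Fin k → ℕ) → Prop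
  | mk {x : V.Joint r} {p : Coins r → Fin k → ℕ} (y : V.Joint r × (Coins r → Fin k → Fin 2))
      (h : Round comm x (fun b => scan w (p b)) y) :
      RoundStep comm w (x, p) (y.1, fun b => move w (p b) (y.2 b))

/-- The joint state at the start. -/
def Joint.init (V : Verifier α k) (r : ℕ) : V.Joint r := ⟨fun _ => V.init.sim r, fun _ _ => True⟩

/-- The simulations in the joint state `x` that have accepted. -/
def Joint.accepted (x : V.Joint r) : Set (Coins r) := {b | (x.sims b).1 = .accept}

/-- The distribution of the heads of an automaton among the simulations. -/
noncomputable def headSplit (k r : ℕ) (X : Type*) :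
    (Fin (Fintype.card (Coins r × Fin k)) → X) ≃ (Coins r → Fin k → X) :=
  (Equiv.arrowCongr (Fintype.equivFin _).symm (.refl X)).trans (Equiv.curry _ _ X)

/-- The automaton that simulates `V` for all outcomes of the coin tosses, guesses the responses of
the prover, and accepts if `V` accepts for more than half of the outcomes. -/
def parallel (V : Verifier α k) (comm : Communication) (r : ℕ) :
    OneWayNFA α (Fintype.card (Coins r × Fin k)) where
  Q := V.Joint r
  start := .init V r
  accept := {x | 2 ^ r < x.accepted.ncard}
  δ x s := {y | Round comm x (headSplit k r _ s) (y.1, headSplit k r _ y.2)}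

variable {comm : Communication} {w : List α}

theorem step_parallel_iff {c c' : V.Joint r × (Fin (Fintype.card (Coins r × Fin k)) → ℕ)} :
    (V.parallel comm r).Step w c c' ↔
      RoundStep comm w (Prod.map id (headSplit k r ℕ) c) (Prod.map id (headSplit k r ℕ) c') := by
  obtain ⟨x, p⟩ := c
  obtain ⟨x', p'⟩ := c'
  constructor
  · rintro ⟨d, hd, h_move⟩
    obtain rfl : p' = move w p d := h_move
    exact .mk _ hd
  · generalize hc' : Prod.map id (headSplit k r ℕ) (x', p') = c'
    rintro ⟨⟨y, d⟩, hy⟩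
    obtain ⟨rfl, hp'⟩ := Prod.ext_iff.1 hc'
    obtain ⟨d, rfl⟩ := (headSplit k r (Fin 2)).surjective d
    exact ⟨d, hy, (headSplit k r ℕ).injective hp'⟩

theorem mem_language_parallel_iff_reflTransGen :
    w ∈ (V.parallel comm r).language ↔ ∃ c : V.Joint r × (Coins r → Fin k → ℕ),
      Relation.ReflTransGen (RoundStep comm w) (.init V r, fun _ _ => 0) c ∧
        2 ^ r < c.1.accepted.ncard := by
  constructor
  · rintro ⟨x, hx, p, h⟩
    exact ⟨_, h.lift (Prod.map id (headSplit k r ℕ)) fun _ _ => step_parallel_iff.1, hx⟩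
  · rintro ⟨c, h, hc⟩
    refine ⟨c.1, hc, (headSplit k r ℕ).symm c.2, ?_⟩
    refine h.lift (Prod.map id (headSplit k r ℕ).symm) fun c c' hcc' => step_parallel_iff.2 ?_
    simpa only [Prod.map_map, Equiv.self_comp_symm, Function.comp_id, Prod.map_id, id] using hcc'

section Represents

variable {P P' : Prover α V.Γ} {N : ℕ} {n : Coins r → ℕ} {x : V.Joint r} {p : Coins r → Fin k → ℕ}
  {f : Coins r → V.Γ}

/-- The symbols `f` are the responses of `P` to the communicating simulations in `x`, after `n b`
steps with the coins `b`. -/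
def AreResponses (P : Prover α V.Γ) (w : List α) (n : Coins r → ℕ) (x : V.Joint r)
    (f : Coins r → V.Γ) : Prop :=
  ∀ b m, V.Sends (x.sims b).1 m → f b = P w (V.run P w b.periodic (n b)).history m

/-- The simulations that have not been given up are those of the interaction with `P`, after `n b`
steps with the coins `b`, and the running ones have had `N` communication steps. -/
structure Represents (P : Prover α V.Γ) (w : List α) (N : ℕ) (n : Coins r → ℕ) (x : V.Joint r)
    (p : Coins r → Fin k → ℕ) : Prop where
  tracks : ∀ b, (x.sims b).1 ≠ .reject → Tracks P w b N (n b) (x.sims b) (p b)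
  same_iff : ∀ b b', V.signal (x.sims b).1 ≠ none → V.signal (x.sims b').1 ≠ none →
    (x.same b b' ↔
      (V.run P w b.periodic (n b)).history = (V.run P w b'.periodic (n b')).history)

theorem ne_reject_of_signal_ne_none {s : VState V.R V.D} (h : V.signal s ≠ none) : s ≠ .reject :=
  fun hs => h (signal_eq_none_iff.2 (.inr hs))

theorem Represents.tracks_of_signal_ne_none (h : Represents P w N n x p) {b : Coins r}
    (hb : V.signal (x.sims b).1 ≠ none) : Tracks P w b N (n b) (x.sims b) (p b) :=
  h.tracks b (ne_reject_of_signal_ne_none hb)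

theorem represents_init (P : Prover α V.Γ) (w : List α) :
    Represents P w 0 (fun _ => 0) (.init V r) fun _ _ => 0 where
  tracks _ _ := ⟨rfl, rfl, le_rfl, fun _ => rfl⟩
  same_iff _ _ _ _ := iff_of_true trivial rfl

theorem Joint.init_ne_reject (b : Coins r) : ((Joint.init V r).sims b).1 ≠ .reject := by
  change Sum.elim VState.coin VState.det V.start ≠ .reject
  rcases V.start with q | q <;> nofun

open Classical in
/-- The numbers of steps after `silentRound`. -/
noncomputable def silentCount (x : V.Joint r) (n : Coins r → ℕ) (b : Coins r) : ℕ :=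
  if V.Silent (x.sims b).1 then n b + 1 else n b

open Classical in
/-- The numbers of steps after `commRound`. -/
noncomputable def commCount (x : V.Joint r) (n : Coins r → ℕ) (b : Coins r) : ℕ :=
  if V.signal (x.sims b).1 = none then n b else n b + 1

theorem le_silentCount (x : V.Joint r) (n : Coins r → ℕ) : n ≤ silentCount x n := by
  intro b
  rw [silentCount]
  split_ifs
  exacts [Nat.le_succ _, le_rfl]

theorem le_commCount (x : V.Joint r) (n : Coins r → ℕ) : n ≤ commCount x n := by
  intro b
  rw [commCount]
  split_ifs
  exacts [le_rfl, Nat.le_succ _]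

theorem Tracks.after_silentRound {b : Coins r} (h : Tracks P w b N (n b) (x.sims b) (p b)) :
    Tracks P w b N (silentCount x n b) ((silentRound x fun b => scan w (p b)).1.sims b)
        (move w (p b) ((silentRound x fun b => scan w (p b)).2 b)) ∧
      (V.run P w b.periodic (silentCount x n b)).history =
        (V.run P w b.periodic (n b)).history := by
  by_cases hs : V.Silent (x.sims b).1
  · simp only [silentRound, silentCount, if_pos hs]
    exact h.silent hs
  · simp only [silentRound, silentCount, if_neg hs]
    exact ⟨h.wait, trivial⟩

theorem Tracks.after_commRound {b : Coins r} (h : Tracks P w b N (n b) (x.sims b) (p b))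
    (hb : ¬ V.Silent (x.sims b).1) (hf : AreResponses P w n x f) :
    Tracks P w b (N + 1) (commCount x n b) ((commRound x (fun b => scan w (p b)) f).1.sims b)
      (move w (p b) ((commRound x (fun b => scan w (p b)) f).2 b)) := by
  simp only [commRound, if_neg hb]
  by_cases h_none : V.signal (x.sims b).1 = none
  · rw [commCount, if_pos h_none, next_of_signal_eq_none h_none]
    exact h.wait.succ_of_halted h_none
  · obtain ⟨m, hm⟩ := exists_sends h_none hb
    rw [commCount, if_neg h_none]
    exact (h.sends hm (hf b m hm)).1

theorem Tracks.history_commCount {b : Coins r} {m : V.Γ}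
    (h : Tracks P w b N (n b) (x.sims b) (p b)) (hm : V.Sends (x.sims b).1 m)
    (hf : AreResponses P w n x f) :
    (V.run P w b.periodic (commCount x n b)).history =
      (V.run P w b.periodic (n b)).history ++ [(m, f b)] := by
  rw [commCount, if_neg hm.signal_ne_none]
  exact (h.sends hm (hf b m hm)).2

theorem signal_ne_none_of_silentRound {s : Coins r → Fin k → Option α} {b : Coins r}
    (h : V.signal ((silentRound x s).1.sims b).1 ≠ none) : V.signal (x.sims b).1 ≠ none := by
  by_cases hs : V.Silent (x.sims b).1
  · exact hs.signal_ne_none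
  · simpa only [silentRound, if_neg hs] using h

theorem not_silent_of_commRound {s : Coins r → Fin k → Option α} {b : Coins r}
    (h : ((commRound x s f).1.sims b).1 ≠ .reject) : ¬ V.Silent (x.sims b).1 :=
  fun hs => h (by simp only [commRound, if_pos hs])

theorem exists_sends_of_commRound {s : Coins r → Fin k → Option α} {b : Coins r}
    (h : V.signal ((commRound x s f).1.sims b).1 ≠ none) : ∃ m, V.Sends (x.sims b).1 m := by
  have hs := not_silent_of_commRound (ne_reject_of_signal_ne_none h)
  refine exists_sends (fun h_none => h ?_) hs
  simp only [commRound, if_neg hs, next_of_signal_eq_none h_none, h_none]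

theorem Represents.after_silentRound (h : Represents P w N n x p) :
    Represents P w N (silentCount x n) (silentRound x fun b => scan w (p b)).1
      fun b => move w (p b) ((silentRound x fun b => scan w (p b)).2 b) where
  tracks b hb := by
    refine (h.tracks b fun hr => hb ?_).after_silentRound.1
    have hs : ¬ V.Silent (x.sims b).1 := fun hs => ne_reject_of_signal_ne_none hs.signal_ne_none hr
    simpa only [silentRound, if_neg hs] using hr
  same_iff b b' hb hb' := by
    replace hb := signal_ne_none_of_silentRound hb
    replace hb' := signal_ne_none_of_silentRound hb'
    rw [(h.tracks_of_signal_ne_none hb).after_silentRound.2,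
      (h.tracks_of_signal_ne_none hb').after_silentRound.2]
    exact h.same_iff b b' hb hb'

theorem Represents.after_commRound (h : Represents P w N n x p) (hf : AreResponses P w n x f) :
    Represents P w (N + 1) (commCount x n) (commRound x (fun b => scan w (p b)) f).1
      fun b => move w (p b) ((commRound x (fun b => scan w (p b)) f).2 b) where
  tracks b hb := by
    have hs := not_silent_of_commRound hb
    refine (h.tracks b fun hr => hb ?_).after_commRound hs hf
    simp only [commRound, if_neg hs, next_of_signal_eq_none (signal_eq_none_iff.2 (.inr hr)), hr]
  same_iff b b' hb hb' := by
    obtain ⟨m, hm⟩ := exists_sends_of_commRound hb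
    obtain ⟨m', hm'⟩ := exists_sends_of_commRound hb'
    rw [(h.tracks_of_signal_ne_none hm.signal_ne_none).history_commCount hm hf,
      (h.tracks_of_signal_ne_none hm'.signal_ne_none).history_commCount hm' hf,
      List.append_singleton_inj, Prod.mk.injEq, hf b m hm, hf b' m' hm',
      ← h.same_iff b b' hm.signal_ne_none hm'.signal_ne_none]
    have h_signal : V.signal (x.sims b).1 = V.signal (x.sims b').1 ↔ m = m' := by
      rw [hm.1, hm'.1, Option.some_inj]
    refine and_congr_right fun h_same => h_signal.trans ⟨fun h_eq => ⟨h_eq, ?_⟩, And.left⟩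
    rw [(h.same_iff b b' hm.signal_ne_none hm'.signal_ne_none).1 h_same, h_eq]

theorem Represents.run_congr_prover (h : Represents P w N n x p)
    (hP : ∀ h s, h.length < N → P' w h s = P w h s) {b : Coins r} (hb : (x.sims b).1 ≠ .reject) :
    V.run P' w b.periodic (n b) = V.run P w b.periodic (n b) :=
  Verifier.run_congr_prover hP (h.tracks b hb).length_le

theorem Represents.congr_prover (h : Represents P w N n x p)
    (hP : ∀ h s, h.length < N → P' w h s = P w h s) : Represents P' w N n x p where
  tracks b hb := by
    obtain ⟨h_sim, h_heads, h_le, h_eq⟩ := h.tracks b hb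
    rw [← h.run_congr_prover hP hb] at h_sim h_heads h_le h_eq
    exact ⟨h_sim, h_heads, h_le, h_eq⟩
  same_iff b b' hb hb' := by
    rw [h.run_congr_prover hP (ne_reject_of_signal_ne_none hb),
      h.run_congr_prover hP (ne_reject_of_signal_ne_none hb')]
    exact h.same_iff b b' hb hb'

theorem Represents.compatible (h : Represents P w N n x p) (hP : P ∈ comm.provers α V.Γ)
    (hf : AreResponses P w n x f) : Compatible comm x f := by
  intro b b' m m' hm hm' h_same
  have hb := h.tracks_of_signal_ne_none hm.signal_ne_none
  have hb' := h.tracks_of_signal_ne_none hm'.signal_ne_none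
  rw [hf b m hm, hf b' m' hm']
  refine Communication.mem_provers_iff.1 hP w _ _ _ _ ?_ fun h_comm => ?_
  · rw [hb.length_eq hm.signal_ne_none, hb'.length_eq hm'.signal_ne_none]
  · exact (h_same h_comm).imp_left (h.same_iff b b' hm.signal_ne_none hm'.signal_ne_none).1

theorem Represents.exists_prover (h : Represents P w N n x p) (hP : P ∈ comm.provers α V.Γ)
    (hf : Compatible comm x f) :
    ∃ P' ∈ comm.provers α V.Γ, Represents P' w N n x p ∧ AreResponses P' w n x f := by
  classical
  -- `P'` gives the response `f b` in the step in which the simulation `b` is, as far as the prover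
  -- can see that.
  let Sees (h' : List (V.Γ × V.Γ)) (s : V.Γ) (b : Coins r) : Prop :=
    h'.length = N ∧ ∃ m, V.Sends (x.sims b).1 m ∧
      (comm = .twoWay → (V.run P w b.periodic (n b)).history = h' ∧ m = s)
  let P' : Prover α V.Γ := fun w' h' s =>
    if ∃ b, Sees h' s b then f (Classical.epsilon (Sees h' s)) else P w' h' s
  have hP'_eq (h' s) (h_lt : h'.length < N) : P' w h' s = P w h' s :=
    if_neg fun ⟨_, h_eq, _⟩ => h_lt.ne h_eq
  refine ⟨P', Communication.mem_provers_iff.2 fun w' h₁ s₁ h₂ s₂ h_length h_eq => ?_,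
    h.congr_prover hP'_eq, fun b m hm => ?_⟩
  · have h_sees : Sees h₁ s₁ = Sees h₂ s₂ := by
      funext b
      simp only [Sees, h_length]
      refine congrArg _ (propext <| exists_congr fun m => and_congr_right fun _ =>
        forall_congr' fun h_comm => ?_)
      rw [(h_eq h_comm).1, (h_eq h_comm).2]
    simp only [P', h_sees, Communication.mem_provers_iff.1 hP w' h₁ s₁ h₂ s₂ h_length h_eq]
  · rw [h.run_congr_prover hP'_eq (ne_reject_of_signal_ne_none hm.signal_ne_none)]
    have h_ex : ∃ b', Sees (V.run P w b.periodic (n b)).history m b' :=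
      ⟨b, (h.tracks_of_signal_ne_none hm.signal_ne_none).length_eq hm.signal_ne_none, m, hm,
        fun _ => ⟨rfl, rfl⟩⟩
    obtain ⟨-, m', hm', h_same⟩ := Classical.epsilon_spec h_ex
    refine Eq.trans (hf b _ m m' hm hm' fun h_comm => ?_) (if_pos h_ex).symm
    obtain ⟨h_history, rfl⟩ := h_same h_comm
    exact ⟨(h.same_iff _ _ hm.signal_ne_none hm'.signal_ne_none).2 h_history.symm, rfl⟩

theorem exists_represents {c : V.Joint r × (Coins r → Fin k → ℕ)}
    (hc : Relation.ReflTransGen (RoundStep comm w) (.init V r, fun _ _ => 0) c) :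
    ∃ P ∈ comm.provers α V.Γ, ∃ N n, Represents P w N n c.1 c.2 := by
  induction hc with
  | refl =>
    exact ⟨fun _ _ _ => V.null, Communication.mem_provers_iff.2 fun _ _ _ _ _ _ _ => rfl, 0, _,
      represents_init _ w⟩
  | tail _ h_step ih =>
    obtain ⟨P, hP, N, n, h⟩ := ih
    obtain ⟨_, _ | ⟨f, hf⟩⟩ := h_step
    · exact ⟨P, hP, N, _, h.after_silentRound⟩
    · obtain ⟨P', hP', h, hf'⟩ := h.exists_prover hP hf
      exact ⟨P', hP', N + 1, _, h.after_commRound hf'⟩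

theorem exists_areResponses (P : Prover α V.Γ) (w : List α) (n : Coins r → ℕ) (x : V.Joint r) :
    ∃ f, AreResponses P w n x f :=
  ⟨fun b => (V.signal (x.sims b).1).elim V.null (P w (V.run P w b.periodic (n b)).history),
    fun b m hm => by simp only [hm.1, Option.elim_some]⟩

theorem Represents.exists_round (h : Represents P w N n x p) (hP : P ∈ comm.provers α V.Γ)
    (hx : ∀ b, V.Accepts P w b.periodic → (x.sims b).1 ≠ .reject)
    (h_run : ∃ b, V.Accepts P w b.periodic ∧ (x.sims b).1 ≠ .accept) :
    ∃ c N' n', RoundStep comm w (x, p) c ∧ Represents P w N' n' c.1 c.2 ∧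
      (∀ b, V.Accepts P w b.periodic → (c.1.sims b).1 ≠ .reject) ∧
      n ≤ n' ∧ ∃ b, V.Accepts P w b.periodic ∧ (x.sims b).1 ≠ .accept ∧ n b < n' b := by
  by_cases h_silent : ∃ b, V.Accepts P w b.periodic ∧ V.Silent (x.sims b).1
  · obtain ⟨b, hb, hs⟩ := h_silent
    refine ⟨_, N, _, .mk _ .silent, h.after_silentRound, fun b hb => ?_, le_silentCount x n, b, hb,
      fun h_acc => hs.signal_ne_none (signal_eq_none_iff.2 (.inl h_acc)), ?_⟩
    · rw [← (h.tracks b (hx b hb)).after_silentRound.1.state_eq]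
      exact hb.state_ne_reject _
    · rw [silentCount, if_pos hs]
      exact Nat.lt_succ_self _
  · push Not at h_silent
    obtain ⟨f, hf⟩ := exists_areResponses P w n x
    obtain ⟨b, hb, h_acc⟩ := h_run
    refine ⟨_, N + 1, _, .mk _ (.comm f (h.compatible hP hf)), h.after_commRound hf,
      fun b hb => ?_, le_commCount x n, b, hb, h_acc, ?_⟩
    · rw [← ((h.tracks b (hx b hb)).after_commRound (h_silent b hb) hf).state_eq]
      exact hb.state_ne_reject _
    · rw [commCount, if_neg fun h_none => (signal_eq_none_iff.1 h_none).elim h_acc (hx b hb)]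
      exact Nat.lt_succ_self _

theorem Represents.exists_computation (h : Represents P w N n x p) (hP : P ∈ comm.provers α V.Γ)
    (hx : ∀ b, V.Accepts P w b.periodic → (x.sims b).1 ≠ .reject) :
    ∃ c, Relation.ReflTransGen (RoundStep comm w) (x, p) c ∧
      {b : Coins r | V.Accepts P w b.periodic} ⊆ c.1.accepted := by
  have h_time (b : Coins r) (hb : V.Accepts P w b.periodic) := hb
  choose! T hT using h_time
  induction hμ : ∑ b, (T b - n b) using Nat.strong_induction_on generalizing N n x p with
  | _ μ ih =>
    by_cases h_run : ∃ b, V.Accepts P w b.periodic ∧ (x.sims b).1 ≠ .accept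
    · obtain ⟨c, N', n', h_step, hc, hcx, h_le, b, hb, h_acc, h_lt⟩ := h.exists_round hP hx h_run
      have h_nT : n b < T b := (h.tracks b (hx b hb)).lt_of_accept h_acc (hT b hb)
      have h_sum : ∑ b, (T b - n' b) < ∑ b, (T b - n b) :=
        Finset.sum_lt_sum (fun b _ => Nat.sub_le_sub_left (h_le b) _)
          ⟨b, Finset.mem_univ b, by omega⟩
      obtain ⟨c', hc', h_accepted⟩ := ih _ (hμ ▸ h_sum) hc hcx rfl
      exact ⟨c', .head h_step hc', h_accepted⟩
    · push Not at h_run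
      exact ⟨_, .refl, h_run⟩

theorem Represents.accepted_subset (h : Represents P w N n x p) :
    x.accepted ⊆ {b : Coins r | V.Accepts P w b.periodic} := fun b hb =>
  ⟨n b, (h.tracks b (hb.trans_ne nofun)).state_eq.trans hb⟩

end Represents

theorem mem_language_parallel_iff :
    w ∈ (V.parallel comm r).language ↔
      ∃ P ∈ comm.provers α V.Γ, 2 ^ r < {b : Coins r | V.Accepts P w b.periodic}.ncard := by
  rw [mem_language_parallel_iff_reflTransGen]
  constructor
  · rintro ⟨c, hc, h_card⟩
    obtain ⟨P, hP, N, n, h⟩ := exists_represents hc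
    exact ⟨P, hP, h_card.trans_le (Set.ncard_le_ncard h.accepted_subset)⟩
  · rintro ⟨P, hP, h_card⟩
    obtain ⟨c, hc, h_accepted⟩ :=
      (represents_init P w).exists_computation hP fun b _ => Joint.init_ne_reject b
    exact ⟨c, hc, h_card.trans_le (Set.ncard_le_ncard h_accepted)⟩

theorem language_parallel {crit : Criterion} {L : Language α} {ε : ℝ} (hV : V.UsesAtMost r)
    (hε : ε < 1 / 2) (hL : IsProofSystem comm crit V L ε) : (V.parallel comm r).language = L := by
  ext w
  simp only [mem_language_parallel_iff, hV.mem_iff_of_isProofSystem hε hL,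
    hV.half_lt_acceptProb_iff]

end Verifier

theorem verifiable_subset_iUnion_classOneNFA (comm : Communication) (crit : Criterion)
    (α : Type*) : verifiable comm crit α ⊆ ⋃ (k : ℕ) (_ : 1 ≤ k), classOneNFA α k := by
  rintro L ⟨k, hk, V, r, hV, ε, -, hε, hL⟩
  have : Nonempty (Fin k) := ⟨⟨0, hk⟩⟩
  exact Set.mem_iUnion₂.2
    ⟨_, Fintype.card_pos, V.parallel comm r, Verifier.language_parallel hV hε hL⟩

end MultiheadVerifier

theorem theorem5p3_general (α : Type*) (comm : MultiheadVerifier.Communication)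
    (crit : MultiheadVerifier.Criterion) :
    MultiheadVerifier.verifiable comm crit α =
      ⋃ (k : ℕ) (_ : 1 ≤ k), MultiheadVerifier.classOneNFA α k :=
  (MultiheadVerifier.verifiable_subset_iUnion_classOneNFA comm crit α).antisymm
    (Set.iUnion₂_subset fun _ hk => MultiheadVerifier.classOneNFA_subset_verifiable comm crit α hk)

theorem theorem5p3 (α : Type*) [Finite α]
    (comm : MultiheadVerifier.Communication) (crit : MultiheadVerifier.Criterion) :
    MultiheadVerifier.verifiable comm crit α =
      ⋃ (k : ℕ) (_ : 1 ≤ k), MultiheadVerifier.classOneNFA α k :=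
  theorem5p3_general α comm crit
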